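/- Fix $\hbar>0$, $\phi,\beta,\gamma,\delta\in\mathbb C$, $\varepsilon\in\mathbb R$ and a horizon $K\in\mathbb N$. **Object and channel.** Let $\mathcal A$ be the polynomial $*$-algebra generated by an operator $x$ with $[x,x^*]=\hbar\mathbf 1$ (the object at any instant $k$; its generator at the instant $k$ is written $x_k$), and let $\mathcal B^\circ$ be the polynomial $*$-algebra generated by operators $v,w$ with $[v,v^*]=(1-|\phi|^2)\hbar\mathbf 1$, $[w,w^*]=(\varepsilon-|\gamma|^2)\hbar\mathbf 1$, $[w,v^*]=-\bar\phi\gamma\hbar\mathbf 1$, $[v,w]=0$. In the step $k-1\to k$ with control $u_{k-1}\in\mathbb C$, $$x_k=\phi x_{k-1}+\beta u_{k-1}+v_k,\qquad y_k=\gamma x_{k-1}+\delta u_{k-1}+w_k$$ in $\mathcal A\otimes\mathcal B^\circ$; then $[x_k,x_k^*]=\hbar\mathbf 1$, $[y_k,y_k^*]=\varepsilon\hbar\mathbf 1$, and $x_k$ commutes with $y_k,y_k^*$. Let $M_k=\mathrm{id}\otimes\rho_k^\circ$ be the partial expectation over the state of the noise $(v_k,w_k)$, where $\rho_k^\circ$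 is a normalized linear functional on $\mathcal B^\circ$ with zero mean ($v,w,v^*,w^*\mapsto0$) and normally ordered covariances $$\rho_k^\circ(v^*v)=\hbar\sigma,\quad\rho_k^\circ(w^*w)=\hbar\nu,\quad\rho_k^\circ(w^*v)=-\hbar\upsilon,\quad\rho_k^\circ(v^*w)=-\hbar\bar\upsilon .$$ The output $y_k$ is measured indirectly by $b_k(d\eta)=\#m_k(\eta-y_k)\#\,d\eta$, where $\#\cdot\#$ orders all adjoints to the left and $m_k$ is a distribution on $\mathbb C$ (a normalized linear functional on polynomials in $\eta,\bar\eta$) with $\int\eta\,m_k=\int\bar\eta\,m_k=0$, $\int|\eta|^2m_k=\hbar\mu$. Neither $\rho_k^\circ$ nor $m_k$ need be Gaussian. Put $B_k(u_{k-1},d\eta)a=M_k[b_k(d\eta)\,a]$, where $a$ is a polynomial in $x_k,x_k^*$; it is integrated against polynomial operator-valued functions of $\eta,\bar\eta$. **Estimates.** With $z_0=z\in\mathbb C$ and $\Sigma_0=\Sigma\in\mathbb R$ (mean and normalized variance of the initial state), let, for $k\ge1$, $\Psi_k=|\gamma|^2\Sigma_{k-1}+\nu+\mu$, $\kappa_k=(\phi\bar\gamma\Sigma_{k-1}-\upsilon)/\Psi_k$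 (with $\kappa_k=0$ if $\Psi_k=0$), $\Sigma_k=|\phi|^2\Sigma_{k-1}+\sigma-|\kappa_k|^2\Psi_k$, and $$z_k=\phi z_{k-1}+\beta u_{k-1}+\kappa_k(\eta_k-\gamma z_{k-1}-\delta u_{k-1}).$$ **Losses and control.** Let $\Omega\ge0$, $\omega\ge0$, $\vartheta^1>0$, $\vartheta\in\mathbb C$; the terminal loss is $\Omega x_K^*x_K$, and for $0\le k<K$ the running loss is $$c_k(u_k)=\omega x_k^*x_k-\vartheta\bar u_kx_k-\bar\vartheta u_kx_k^*+\vartheta^1|u_k|^2 .$$ Put $\Omega_K=\Omega$, $\Gamma_K=0$, and for $0\le k<K$ $$\Upsilon_k=|\beta|^2\Omega_{k+1}+\vartheta^1,\quad\Lambda_k=\phi\bar\beta\Omega_{k+1}-\vartheta,\quad\lambda_k=\Lambda_k/\Upsilon_k,\quad\Omega_k=|\phi|^2\Omega_{k+1}+\omega-|\lambda_k|^2\Upsilon_k,$$ $$\Gamma_k=|\lambda_k|^2\Upsilon_k+|\phi-\kappa_{k+1}\gamma|^2\Gamma_{k+1},\quad d_k=\hbar\sum_{i=k+1}^K\Bigl(\Omega_i\sigma+\Gamma_i\bigl(\sigma+2\,\mathrm{Re}\,\kappa_i\bar\upsilon+(\nu+\mu)|\kappa_i|^2\bigr)\Bigr),$$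 and assume $\Upsilon_k\ne0$ for all $0\le k<K$. For data $\zeta^{k+1}=(u_0,\eta_1,u_1,\dots,\eta_k,u_k)$ let the operators of future losses $a_k(\zeta^{k+1})\in\mathcal A$ under the linear strategy $u_k=-\lambda_kz_k$ be defined by $a_K=\Omega x_K^*x_K$ and, for $0\le k<K$, $$a_k(\zeta^{k+1})=\int B_{k+1}(u_k,d\eta)\,a_{k+1}\bigl(\zeta^{k+1},\eta,-\lambda_{k+1}z_{k+1}\bigr)+c_k(u_k)$$ (the last control being irrelevant, as $a_K$ does not depend on the data). **Theorem.** For every $0\le k<K$ and all data $\zeta^{k+1}$ (with arbitrary controls), the integrand in this recursion is a polynomial in $\eta,\bar\eta$ with coefficients in $\mathcal A$, so that the integral is defined, and $$a_k(\zeta^{k+1})=d_k\mathbf 1+\Upsilon_k|u_k+\lambda_kz_k|^2\mathbf 1+\Omega_kx_k^*x_k+\Gamma_k(z_k-x_k)^*(z_k-x_k)-2\,\mathrm{Re}\,\Lambda_k\overline{(u_k+\lambda_kz_k)}\,(z_k-x_k),$$ where $2\,\mathrm{Re}\,T=T+T^*$. -/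

import Mathlib

open scoped TensorProduct ComplexConjugate

noncomputable section

namespace QControl

/-! ### The polynomial `*`-algebra of the canonical commutation relations -/

/-- Free generators: `inl i` stands for the operator `a i`, `inr i` for its adjoint. -/
abbrev FreeGen (ι : Type) := FreeAlgebra ℂ (ι ⊕ ι)

/-- `[a i, a j] = 0`, `[a i*, a j*] = 0` and `[a i, a j*] = C i j`. -/
inductive CCRRel {ι : Type} (C : selfAdjoint (Matrix ι ι ℂ)) : FreeGen ι → FreeGen ι → Prop
  | ann (i j : ι) : CCRRel C
      (FreeAlgebra.ι ℂ (Sum.inl i) * FreeAlgebra.ι ℂ (Sum.inl j))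
      (FreeAlgebra.ι ℂ (Sum.inl j) * FreeAlgebra.ι ℂ (Sum.inl i))
  | cre (i j : ι) : CCRRel C
      (FreeAlgebra.ι ℂ (Sum.inr i) * FreeAlgebra.ι ℂ (Sum.inr j))
      (FreeAlgebra.ι ℂ (Sum.inr j) * FreeAlgebra.ι ℂ (Sum.inr i))
  | mixed (i j : ι) : CCRRel C
      (FreeAlgebra.ι ℂ (Sum.inl i) * FreeAlgebra.ι ℂ (Sum.inr j))
      (FreeAlgebra.ι ℂ (Sum.inr j) * FreeAlgebra.ι ℂ (Sum.inl i)
        + algebraMap ℂ (FreeGen ι) (C.1 i j))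

/-- The unital complex algebra generated by operators `a i` and their adjoints `a i*`, subject
exactly to the canonical commutation relations with Hermitian commutator matrix `C`. -/
abbrev CCR {ι : Type} (C : selfAdjoint (Matrix ι ι ℂ)) : Type := RingQuot (CCRRel C)

variable {ι : Type} {C : selfAdjoint (Matrix ι ι ℂ)}

/-- The generator `a i`. -/
def gen (C : selfAdjoint (Matrix ι ι ℂ)) (i : ι) : CCR C :=
  RingQuot.mkAlgHom ℂ (CCRRel C) (FreeAlgebra.ι ℂ (Sum.inl i))

/-- The adjoint generator `a i*` (see `star_gen`). -/
def genAdj (C : selfAdjoint (Matrix ι ι ℂ)) (i : ι) : CCR C :=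
  RingQuot.mkAlgHom ℂ (CCRRel C) (FreeAlgebra.ι ℂ (Sum.inr i))

theorem gen_mul_gen (i j : ι) : gen C i * gen C j = gen C j * gen C i := by
  simpa [gen] using RingQuot.mkAlgHom_rel ℂ (CCRRel.ann (C := C) i j)

theorem genAdj_mul_genAdj (i j : ι) : genAdj C i * genAdj C j = genAdj C j * genAdj C i := by
  simpa [genAdj] using RingQuot.mkAlgHom_rel ℂ (CCRRel.cre (C := C) i j)

theorem gen_mul_genAdj (i j : ι) :
    gen C i * genAdj C j = genAdj C j * gen C i + algebraMap ℂ (CCR C) (C.1 i j) := by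
  have h := RingQuot.mkAlgHom_rel ℂ (CCRRel.mixed (C := C) i j)
  rw [map_mul, map_add, map_mul, AlgHom.commutes] at h
  exact h

/-- Universal property: operators satisfying the same commutation relations in any complex algebra
define a homomorphism. -/
def ccrLift {R : Type} [Ring R] [Algebra ℂ R] (f g : ι → R)
    (hf : ∀ i j, f i * f j = f j * f i) (hg : ∀ i j, g i * g j = g j * g i)
    (hfg : ∀ i j, f i * g j = g j * f i + algebraMap ℂ R (C.1 i j)) : CCR C →ₐ[ℂ] R :=
  RingQuot.liftAlgHom ℂ ⟨FreeAlgebra.lift ℂ (Sum.elim f g), by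
    intro p q h
    cases h with
    | ann i j => simpa using hf i j
    | cre i j => simpa using hg i j
    | mixed i j => simpa using hfg i j⟩

section

variable {R : Type} [Ring R] [Algebra ℂ R] (f g : ι → R)
    (hf : ∀ i j, f i * f j = f j * f i) (hg : ∀ i j, g i * g j = g j * g i)
    (hfg : ∀ i j, f i * g j = g j * f i + algebraMap ℂ R (C.1 i j))

@[simp] theorem ccrLift_gen (i : ι) : ccrLift (C := C) f g hf hg hfg (gen C i) = f i := by
  simp [ccrLift, gen]

@[simp] theorem ccrLift_genAdj (i : ι) : ccrLift (C := C) f g hf hg hfg (genAdj C i) = g i := by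
  simp [ccrLift, genAdj]

end

/-- The opposite ring with the conjugated complex structure, so that a conjugate-linear
anti-homomorphism into `R` is a homomorphism into `ConjOp R`. -/
def ConjOp (R : Type) : Type := Rᵐᵒᵖ

instance (R : Type) [Ring R] : Ring (ConjOp R) := inferInstanceAs (Ring Rᵐᵒᵖ)

instance (R : Type) [Ring R] [Algebra ℂ R] : Algebra ℂ (ConjOp R) :=
  RingHom.toAlgebra' ((algebraMap ℂ Rᵐᵒᵖ).comp (starRingEnd ℂ))
    (fun c x => Algebra.commutes (R := ℂ) (A := Rᵐᵒᵖ) (conj c) x)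

/-- The involution as a homomorphism into the conjugate opposite algebra. -/
def starHom (C : selfAdjoint (Matrix ι ι ℂ)) : CCR C →ₐ[ℂ] ConjOp (CCR C) :=
  ccrLift (fun i => MulOpposite.op (genAdj C i)) (fun i => MulOpposite.op (gen C i))
    (fun i j => congrArg MulOpposite.op (genAdj_mul_genAdj j i))
    (fun i j => congrArg MulOpposite.op (gen_mul_gen j i))
    (fun i j => by
      have h := gen_mul_genAdj (C := C) j i
      have hC : C.1 j i = conj (C.1 i j) := by
        have := congrFun (congrFun C.2 j) i
        rw [← this]
        simp [Matrix.star_apply]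
      rw [hC] at h
      exact congrArg MulOpposite.op h)

theorem ccr_induction {motive : CCR C → Prop} (h0 : ∀ r : ℂ, motive (algebraMap ℂ _ r))
    (h1 : ∀ i, motive (gen C i)) (h2 : ∀ i, motive (genAdj C i))
    (hm : ∀ a b, motive a → motive b → motive (a * b))
    (ha : ∀ a b, motive a → motive b → motive (a + b)) (a : CCR C) : motive a := by
  obtain ⟨p, rfl⟩ := RingQuot.mkAlgHom_surjective ℂ (CCRRel C) a
  induction p using FreeAlgebra.induction with
  | grade0 r => rw [AlgHom.commutes]; exact h0 r
  | grade1 x =>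
    cases x with
    | inl i => exact h1 i
    | inr i => exact h2 i
  | mul a b iha ihb => rw [map_mul]; exact hm _ _ iha ihb
  | add a b iha ihb => rw [map_add]; exact ha _ _ iha ihb

/-- The adjoint operation of the algebra of canonical commutation relations. -/
def ccrStar (a : CCR C) : CCR C := MulOpposite.unop (starHom C a)

theorem ccrStar_mul (a b : CCR C) : ccrStar (a * b) = ccrStar b * ccrStar a :=
  congrArg MulOpposite.unop (map_mul (starHom C) a b)

theorem ccrStar_add (a b : CCR C) : ccrStar (a + b) = ccrStar a + ccrStar b :=
  congrArg MulOpposite.unop (map_add (starHom C) a b)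

theorem ccrStar_algebraMap (c : ℂ) :
    ccrStar (algebraMap ℂ (CCR C) c) = algebraMap ℂ (CCR C) (conj c) :=
  congrArg MulOpposite.unop ((starHom C).commutes c)

theorem ccrStar_gen (i : ι) : ccrStar (gen C i) = genAdj C i :=
  congrArg MulOpposite.unop (ccrLift_gen (R := ConjOp (CCR C)) _ _ _ _ _ i)

theorem ccrStar_genAdj (i : ι) : ccrStar (genAdj C i) = gen C i :=
  congrArg MulOpposite.unop (ccrLift_genAdj (R := ConjOp (CCR C)) _ _ _ _ _ i)

theorem ccrStar_ccrStar (a : CCR C) : ccrStar (ccrStar a) = a := by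
  induction a using ccr_induction with
  | h0 r => simp [ccrStar_algebraMap]
  | h1 i => rw [ccrStar_gen, ccrStar_genAdj]
  | h2 i => rw [ccrStar_genAdj, ccrStar_gen]
  | hm a b iha ihb => rw [ccrStar_mul, ccrStar_mul, iha, ihb]
  | ha a b iha ihb => rw [ccrStar_add, ccrStar_add, iha, ihb]

instance : StarRing (CCR C) where
  star := ccrStar
  star_involutive := ccrStar_ccrStar
  star_mul := ccrStar_mul
  star_add := ccrStar_add

instance : StarModule ℂ (CCR C) where
  star_smul c a := by
    change ccrStar (c • a) = conj c • ccrStar a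
    rw [Algebra.smul_def, ccrStar_mul, ccrStar_algebraMap, Algebra.smul_def, Algebra.commutes]

@[simp] theorem star_gen (i : ι) : star (gen C i) = genAdj C i := ccrStar_gen i

@[simp] theorem star_genAdj (i : ι) : star (genAdj C i) = gen C i := ccrStar_genAdj i

/-! ### The controlled linear quantum oscillator and its output channel -/

/-- Parameters of the discrete linear Markovian quantum open oscillator
`x' = φ x + β u + v`, `y' = γ x + δ u + w`, where `[x, x*] = ℏ` and `[y', y'*] = ε ℏ`. -/
structure Oscillator where
  hbar : ℝ
  hbar_pos : 0 < hbar
  φ : ℂ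
  β : ℂ
  γ : ℂ
  δ : ℂ
  ε : ℝ

namespace Oscillator

variable (S : Oscillator)

/-- `[x, x*] = ℏ`. -/
def objForm : selfAdjoint (Matrix (Fin 1) (Fin 1) ℂ) :=
  ⟨!![(S.hbar : ℂ)], by
    change _ = _
    ext i j
    fin_cases i; fin_cases j
    simp⟩

/-- `[v, v*] = (1 - |φ|²) ℏ`, `[w, w*] = (ε - |γ|²) ℏ`, `[w, v*] = - conj φ γ ℏ`. -/
def noiseForm : selfAdjoint (Matrix (Fin 2) (Fin 2) ℂ) :=
  ⟨!![(1 - S.φ * conj S.φ) * S.hbar, -(S.φ * conj S.γ * S.hbar);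
      -(conj S.φ * S.γ * S.hbar), (S.ε - S.γ * conj S.γ) * S.hbar], by
    change _ = _
    ext i j
    fin_cases i <;> fin_cases j <;> simp [mul_comm]⟩

/-- The algebra of the object at any instant of time. -/
abbrev Obj : Type := CCR S.objForm

/-- The algebra of the noise pair `(v, w)` of one time step. -/
abbrev Noise : Type := CCR S.noiseForm

/-- The complex amplitude of the object. -/
def x : S.Obj := gen S.objForm 0

def v : S.Noise := gen S.noiseForm 0

def w : S.Noise := gen S.noiseForm 1

/-- Object before a time step together with the noise of this step; this is also the algebra
generated by the object after the step and the output channel of the step. -/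
abbrev Joint : Type := S.Obj ⊗[ℂ] S.Noise

/-- The amplitude after one step with control `u`. -/
def xNext (u : ℂ) : S.Joint :=
  S.φ • (S.x ⊗ₜ[ℂ] 1) + (S.β * u) • 1 + 1 ⊗ₜ[ℂ] S.v

/-- The output of one step with control `u`. -/
def yNext (u : ℂ) : S.Joint :=
  S.γ • (S.x ⊗ₜ[ℂ] 1) + (S.δ * u) • 1 + 1 ⊗ₜ[ℂ] S.w

theorem x_comm : S.x * star S.x = star S.x * S.x + (S.hbar : ℂ) • 1 := by
  have h := gen_mul_genAdj (C := S.objForm) 0 0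
  rw [← star_gen, Algebra.algebraMap_eq_smul_one] at h
  exact h

theorem v_comm : S.v * star S.v = star S.v * S.v
    + ((1 - S.φ * conj S.φ) * S.hbar) • 1 := by
  have h := gen_mul_genAdj (C := S.noiseForm) 0 0
  rw [← star_gen, Algebra.algebraMap_eq_smul_one] at h
  exact h

theorem xNext_comm (u : ℂ) :
    S.xNext u * star (S.xNext u) = star (S.xNext u) * S.xNext u
      + algebraMap ℂ S.Joint S.hbar := by
  rw [Algebra.algebraMap_eq_smul_one]
  simp only [xNext, star_add, star_smul, TensorProduct.star_tmul, star_one, add_mul, mul_add,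
    smul_mul_assoc, mul_smul_comm, Algebra.TensorProduct.tmul_mul_tmul, one_mul, mul_one,
    x_comm, v_comm, TensorProduct.tmul_add, TensorProduct.add_tmul, TensorProduct.tmul_smul,
    ← TensorProduct.smul_tmul', smul_add, smul_smul, Algebra.TensorProduct.one_def,
    RCLike.star_def]
  module

theorem w_comm : S.w * star S.w = star S.w * S.w
    + ((S.ε - S.γ * conj S.γ) * S.hbar) • 1 := by
  have h := gen_mul_genAdj (C := S.noiseForm) 1 1
  rw [← star_gen, Algebra.algebraMap_eq_smul_one] at h
  exact h

theorem w_v_comm : S.w * star S.v = star S.v * S.w + (-(conj S.φ * S.γ * S.hbar)) • 1 := by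
  have h := gen_mul_genAdj (C := S.noiseForm) 1 0
  rw [← star_gen, Algebra.algebraMap_eq_smul_one] at h
  exact h

theorem yNext_comm (u : ℂ) :
    S.yNext u * star (S.yNext u) = star (S.yNext u) * S.yNext u
      + ((S.ε : ℂ) * S.hbar) • 1 := by
  simp only [yNext, star_add, star_smul, TensorProduct.star_tmul, star_one, add_mul, mul_add,
    smul_mul_assoc, mul_smul_comm, Algebra.TensorProduct.tmul_mul_tmul, one_mul, mul_one,
    x_comm, w_comm, TensorProduct.tmul_add, TensorProduct.add_tmul, TensorProduct.tmul_smul,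
    ← TensorProduct.smul_tmul', smul_add, smul_smul, Algebra.TensorProduct.one_def,
    RCLike.star_def]
  module

/-- Nondemolition: the output commutes with the object after the step. -/
theorem yNext_xNext (u : ℂ) : S.yNext u * S.xNext u = S.xNext u * S.yNext u := by
  have h : S.w * S.v = S.v * S.w := gen_mul_gen (C := S.noiseForm) 1 0
  simp only [xNext, yNext, add_mul, mul_add,
    smul_mul_assoc, mul_smul_comm, Algebra.TensorProduct.tmul_mul_tmul, one_mul, mul_one,
    h, smul_add, smul_smul]
  module

/-- Nondemolition: the output commutes with the object after the step. -/
theorem yNext_star_xNext (u : ℂ) :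
    S.yNext u * star (S.xNext u) = star (S.xNext u) * S.yNext u := by
  simp only [xNext, yNext, star_add, star_smul, TensorProduct.star_tmul, star_one, add_mul,
    mul_add, smul_mul_assoc, mul_smul_comm, Algebra.TensorProduct.tmul_mul_tmul, one_mul, mul_one,
    x_comm, w_v_comm, TensorProduct.tmul_add, TensorProduct.add_tmul, TensorProduct.tmul_smul,
    ← TensorProduct.smul_tmul', smul_add, smul_smul, Algebra.TensorProduct.one_def,
    RCLike.star_def]
  module

/-- The Heisenberg dynamics of one step: the operator `x` of the object after the step is
`φ x + β u + v`. -/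
def evolve (u : ℂ) : S.Obj →ₐ[ℂ] S.Joint :=
  ccrLift (fun _ => S.xNext u) (fun _ => star (S.xNext u)) (fun _ _ => rfl) (fun _ _ => rfl)
    (fun i j => by
      have : S.objForm.1 i j = S.hbar := by
        fin_cases i; fin_cases j; rfl
      rw [this]
      exact S.xNext_comm u)

end Oscillator

/-! ### Ordered symbols, measurements and transition superoperators -/

/-- Polynomial symbols `f(η, conj η)`: the variable `0` is `η`, the variable `1` is `conj η`. -/
abbrev Symb : Type := MvPolynomial (Fin 2) ℂ

/-- The operator `# f(y) #`: the operator `y` acts first, then its adjoint. -/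
def ordered {R : Type} [Ring R] [StarRing R] [Algebra ℂ R] (y : R) (f : Symb) : R :=
  ∑ s ∈ f.support, f.coeff s • (star y ^ s 1 * y ^ s 0)

/-- Partial application of a functional on the second factor, `a ⊗ b ↦ ρ b • a`. -/
def slice {A B : Type} [AddCommGroup A] [Module ℂ A] [AddCommGroup B] [Module ℂ B]
    (ρ : B →ₗ[ℂ] ℂ) : A ⊗[ℂ] B →ₗ[ℂ] A :=
  (TensorProduct.rid ℂ A).toLinearMap ∘ₗ LinearMap.lTensor A ρ

/-- The symbol `η' ↦ ∫ f(η) m(η - η') dη = ∫ f(η' + ω) m(ω) dω`. The distribution `m` is given as a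
linear functional on polynomial symbols, which covers probability densities and measures as well as
generalized functions. -/
def smear (m : Symb →ₗ[ℂ] ℂ) (f : Symb) : Symb :=
  slice m (MvPolynomial.aeval
    (fun i => (MvPolynomial.X i ⊗ₜ[ℂ] 1 + 1 ⊗ₜ[ℂ] MvPolynomial.X i : Symb ⊗[ℂ] Symb)) f)

/-- `∫ f(η) b(dη)` for the indirect measurement `b(dη) = # m(η - y) # dη`. -/
def measInt {R : Type} [Ring R] [StarRing R] [Algebra ℂ R] (m : Symb →ₗ[ℂ] ℂ) (y : R)
    (f : Symb) : R :=
  ordered y (smear m f)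

namespace Oscillator

variable (S : Oscillator)

/-- The transition superoperator `M`: the partial expectation over the state `ρ` of the noise,
`M [a ⊗ b] = ρ b • a`. The state is given as a linear functional on the noise algebra. -/
def transition (ρ : S.Noise →ₗ[ℂ] ℂ) : S.Joint →ₗ[ℂ] S.Obj := slice ρ

/-- `∫ f(η) B(dη) a`, where `B(dη) a = M [b(dη) a]` with `b(dη) = # m(η - y) # dη`; the
operator `a` of the object after the step commutes with the output `y` of the step. -/
def instr (u : ℂ) (ρ : S.Noise →ₗ[ℂ] ℂ) (m : Symb →ₗ[ℂ] ℂ) (f : Symb) (a : S.Obj) : S.Obj :=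
  S.transition ρ (measInt m (S.yNext u) f * S.evolve u a)

/-- The monomial `(conj η)^i η^j`. -/
def mono (p : ℕ × ℕ) : Symb := MvPolynomial.X 1 ^ p.1 * MvPolynomial.X 0 ^ p.2

/-- `F` is the polynomial function of `η, conj η` with operator coefficients `c`. -/
def HasCoeffs (F : ℂ → S.Obj) (c : ℕ × ℕ →₀ S.Obj) : Prop :=
  ∀ η : ℂ, F η = c.sum fun p a => (conj η ^ p.1 * η ^ p.2) • a

/-- `F` is a polynomial operator-valued function of the measurement result, so that it can be
integrated against `B(dη)`. -/
def PolyIntegrable (F : ℂ → S.Obj) : Prop := ∃ c, S.HasCoeffs F c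

open Classical in
/-- `∫ B(dη) F(η)` for a polynomial operator-valued function `F` of the measurement result (the
coefficients of `F` are unique, see `instrInt_eq`). -/
def instrInt (u : ℂ) (ρ : S.Noise →ₗ[ℂ] ℂ) (m : Symb →ₗ[ℂ] ℂ) (F : ℂ → S.Obj) : S.Obj :=
  if h : S.PolyIntegrable F then h.choose.sum fun p a => S.instr u ρ m (mono p) a else 0

theorem HasCoeffs.unique {F : ℂ → S.Obj} {c c' : ℕ × ℕ →₀ S.Obj} (h : S.HasCoeffs F c)
    (h' : S.HasCoeffs F c') : c = c' := by
  classical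
  ext p
  rw [← sub_eq_zero, ← Module.forall_dual_apply_eq_zero_iff ℂ]
  intro l
  let e : (ℕ × ℕ) ≃ (Fin 2 →₀ ℕ) :=
    (finTwoArrowEquiv ℕ).symm.trans Finsupp.equivFunOnFinite.symm
  let P : MvPolynomial (Fin 2) ℂ :=
    ∑ q ∈ (c - c').support, MvPolynomial.monomial (e q) (l ((c - c') q))
  have hP : ∀ η : ℂ, MvPolynomial.eval ![conj η, η] P = 0 := by
    intro η
    have h1 : ((c - c').sum fun q a => (conj η ^ q.1 * η ^ q.2) • a) = 0 := by
      rw [Finsupp.sum_sub_index (by intros; rw [smul_sub]), ← h η, ← h' η, sub_self]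
    have h2 := congrArg l h1
    rw [map_zero, Finsupp.sum, map_sum] at h2
    rw [map_sum, ← h2]
    refine Finset.sum_congr rfl fun q _ => ?_
    rw [MvPolynomial.eval_monomial, Finsupp.prod_fintype _ _ (by simp)]
    simp [e, mul_comm]
  let g : Fin 2 → MvPolynomial (Fin 2) ℂ :=
    ![MvPolynomial.X 0 - MvPolynomial.C Complex.I * MvPolynomial.X 1,
      MvPolynomial.X 0 + MvPolynomial.C Complex.I * MvPolynomial.X 1]
  have hg : ∀ y : Fin 2 → ℂ, MvPolynomial.eval y (MvPolynomial.bind₁ g P) =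
      MvPolynomial.eval ![y 0 - Complex.I * y 1, y 0 + Complex.I * y 1] P := by
    intro y
    rw [← MvPolynomial.coe_aeval_eq_eval, RingHom.coe_coe, MvPolynomial.aeval_bind₁,
      ← MvPolynomial.coe_aeval_eq_eval, RingHom.coe_coe]
    congr 2
    funext i
    fin_cases i <;> simp [g]
  have hQ : MvPolynomial.bind₁ g P = 0 := by
    refine MvPolynomial.funext_set (fun _ => Set.range ((↑) : ℝ → ℂ))
      (fun _ => Set.infinite_range_of_injective Complex.ofReal_injective) fun y hy => ?_
    obtain ⟨r, hr⟩ := hy 0 trivial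
    obtain ⟨t, ht⟩ := hy 1 trivial
    rw [hg, map_zero, ← hP (r + Complex.I * t), ← hr, ← ht]
    simp [sub_eq_add_neg]
  have hP0 : P = 0 := by
    refine MvPolynomial.funext fun y => ?_
    have := hg ![(y 0 + y 1) / 2, (y 1 - y 0) / (2 * Complex.I)]
    rw [hQ, map_zero] at this
    rw [map_zero, this]
    congr 2
    funext i
    fin_cases i <;> simp <;> field_simp <;> ring
  have hc : P.coeff (e p) = l ((c - c') p) := by
    simp only [P, MvPolynomial.coeff_sum, MvPolynomial.coeff_monomial, e.injective.eq_iff]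
    rw [Finset.sum_ite_eq']
    split_ifs with hp
    · rfl
    · rw [Finsupp.notMem_support_iff.1 hp, map_zero]
  rw [← Finsupp.sub_apply, ← hc, hP0, MvPolynomial.coeff_zero]

theorem instrInt_eq (u : ℂ) (ρ : S.Noise →ₗ[ℂ] ℂ) (m : Symb →ₗ[ℂ] ℂ) {F : ℂ → S.Obj}
    {c : ℕ × ℕ →₀ S.Obj} (h : S.HasCoeffs F c) :
    S.instrInt u ρ m F = c.sum fun p a => S.instr u ρ m (mono p) a := by
  have hF : S.PolyIntegrable F := ⟨c, h⟩
  rw [instrInt, dif_pos hF, HasCoeffs.unique S hF.choose_spec h]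

/-! ### Moments of the noise and of the measurement -/

/-- The functional `ρ` on the noise algebra is normalized, has zero mean and the normally ordered
covariances `⟨v* v⟩ = ℏ σ`, `⟨w* w⟩ = ℏ ν`, `⟨w* v⟩ = - ℏ υ`. No other moment is restricted. -/
structure NoiseMoments (σ ν : ℝ) (υ : ℂ) (ρ : S.Noise →ₗ[ℂ] ℂ) : Prop where
  one : ρ 1 = 1
  mean_v : ρ S.v = 0
  mean_v_star : ρ (star S.v) = 0
  mean_w : ρ S.w = 0
  mean_w_star : ρ (star S.w) = 0
  cov_vv : ρ (star S.v * S.v) = S.hbar * σ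
  cov_ww : ρ (star S.w * S.w) = S.hbar * ν
  cov_wv : ρ (star S.w * S.v) = -(S.hbar * υ)
  cov_vw : ρ (star S.v * S.w) = -(S.hbar * conj υ)

/-- The distribution `m` is normalized, has zero mean and the covariance
`∫ |η|² m(η) dη = ℏ μ`. No other moment is restricted. -/
structure MeasMoments (μ : ℝ) (m : Symb →ₗ[ℂ] ℂ) : Prop where
  one : m 1 = 1
  mean : m (MvPolynomial.X 0) = 0
  mean_conj : m (MvPolynomial.X 1) = 0
  cov : m (MvPolynomial.X 1 * MvPolynomial.X 0) = S.hbar * μ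

/-! ### Kalman filter, data, losses -/

/-- `Ψ = |γ|² Σ + ν + μ` for the error variance `Σ` of the preceding instant. -/
def innov (ν μ s : ℝ) : ℝ := ‖S.γ‖ ^ 2 * s + (ν + μ)

/-- The gain `κ = (φ conj γ Σ - υ) / Ψ`. -/
def gain (ν μ : ℝ) (υ : ℂ) (s : ℝ) : ℂ := (S.φ * conj S.γ * s - υ) / (S.innov ν μ s : ℂ)

/-- The sequence `Σ k` of the Kalman filter. -/
def errVar (σ ν μ : ℝ) (υ : ℂ) (s₀ : ℝ) : ℕ → ℝ
  | 0 => s₀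
  | k + 1 => ‖S.φ‖ ^ 2 * errVar σ ν μ υ s₀ k + σ
      - ‖S.gain ν μ υ (errVar σ ν μ υ s₀ k)‖ ^ 2 * S.innov ν μ (errVar σ ν μ υ s₀ k)

/-- The gains `κ k`, `k ≥ 1`, of the Kalman filter (`κ 0` is not used). -/
def kappa (σ ν μ : ℝ) (υ : ℂ) (s₀ : ℝ) : ℕ → ℂ
  | 0 => 0
  | k + 1 => S.gain ν μ υ (S.errVar σ ν μ υ s₀ k)

end Oscillator

/-- The data `ζ = (u 0, η 1, u 1, …, η k, u k)` available after `k` steps. -/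
def Hist : ℕ → Type
  | 0 => ℂ
  | k + 1 => Hist k × ℂ × ℂ

/-- The last control `u k`. -/
def Hist.ctrl : {k : ℕ} → Hist k → ℂ
  | 0, ζ => ζ
  | _ + 1, ζ => ζ.2.2

/-- The data after one more step with result `η` and subsequent control `u`. -/
def Hist.snoc {k : ℕ} (ζ : Hist k) (η u : ℂ) : Hist (k + 1) := (ζ, η, u)

namespace Oscillator

variable (S : Oscillator)

/-- One step of the filter with gain `κ`, from the estimate `z`, with control `u` and result `η`. -/
def filterStep (κ z u η : ℂ) : ℂ := S.φ * z + S.β * u + κ * (η - S.γ * z - S.δ * u)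

/-- The estimate `z k`, as a function of the data, for the gains `κ` and `z 0 = z₀`. -/
def est (κ : ℕ → ℂ) (z₀ : ℂ) : {k : ℕ} → Hist k → ℂ
  | 0, _ => z₀
  | k + 1, ζ => S.filterStep (κ (k + 1)) (est κ z₀ (k := k) ζ.1) (Hist.ctrl (k := k) ζ.1) ζ.2.1

/-- The running loss `ω x* x - ϑ conj u x - conj ϑ u x* + ϑ₁ |u|²`. -/
def runLoss (ω ϑ₁ : ℝ) (ϑ u : ℂ) : S.Obj :=
  (ω : ℂ) • (star S.x * S.x) - (ϑ * conj u) • S.x - (conj ϑ * u) • star S.x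
    + ((ϑ₁ * ‖u‖ ^ 2 : ℝ) : ℂ) • 1

/-- The operators `a k` of future losses: `a K` is the terminal loss `Ω x* x`, and
`a k (ζ) = ∫ B (u k; dη) a (k+1) (ζ, η, - lam (k+1) z (k+1)) + c (u k)` for `k < K`. -/
structure IsFutureLoss (K : ℕ) (ΩK ω ϑ₁ : ℝ) (ϑ : ℂ) (ρ : ℕ → S.Noise →ₗ[ℂ] ℂ)
    (m : ℕ → Symb →ₗ[ℂ] ℂ) (κ : ℕ → ℂ) (z₀ : ℂ) (lam : ℕ → ℂ) (a : (k : ℕ) → Hist k → S.Obj) :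
    Prop where
  final : ∀ ζ : Hist K, a K ζ = (ΩK : ℂ) • (star S.x * S.x)
  step : ∀ k < K, ∀ ζ : Hist k, a k ζ =
    S.instrInt ζ.ctrl (ρ (k + 1)) (m (k + 1)) (fun η =>
      a (k + 1) (ζ.snoc η (-lam (k + 1) * S.filterStep (κ (k + 1)) (S.est κ z₀ ζ) ζ.ctrl η)))
    + S.runLoss ω ϑ₁ ϑ ζ.ctrl

end Oscillator

end QControl

end

/-! Dynamic programming works here because the cost-to-go stays quadratic under one step of the
channel. Under `u = -λ z` the control deviation vanishes, so the next operator of future losses has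
the form `D + Ω x* x + Γ (z - x)* (z - x)`. As a function of the result it is quadratic, since the
new estimate is `A + κ η`.

Integrating such a polynomial needs only moments up to second order: `η` becomes `y`, and `|η|²`
becomes `y* y + ℏ μ`. Because `y` commutes with the adjoint of the new amplitude, the terms
reassemble into a normally ordered square of `A + κ y - x'` (`indirect_square`). This error is
linear in the old error and the noise (`filterStep_sub_xNext`), so zero means remove the cross terms
and the covariances leave a scalar. Everything is kept normally ordered, hence neither Gaussianity
nor further commutator constants enter. `instrInt_quadratic` combines these facts.

What remains is algebra: with the running loss, completing the square gives `Υ (u + λ x)* (u + λ x)`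
plus the new `Ω x* x`, and substituting `x = z - (z - x)` yields the deviation, error and cross
terms (`bellman_step`). A backward induction then iterates the step. -/

namespace QControl

/-! ### Ordered symbols and smearing -/

section Ordered

variable {R : Type} [Ring R] [StarRing R] [Algebra ℂ R] (y : R)

/-- Supports can shrink under addition; summing over a common larger set makes linearity visible. -/
theorem ordered_eq_sum_of_subset {f : Symb} {t : Finset (Fin 2 →₀ ℕ)} (h : f.support ⊆ t) :
    ordered y f = ∑ s ∈ t, f.coeff s • (star y ^ s 1 * y ^ s 0) := by
  refine Finset.sum_subset h fun s _ hs => ?_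
  rw [MvPolynomial.notMem_support_iff.1 hs, zero_smul]

theorem ordered_add (f g : Symb) : ordered y (f + g) = ordered y f + ordered y g := by
  classical
  rw [ordered_eq_sum_of_subset y (t := f.support ∪ g.support) MvPolynomial.support_add,
    ordered_eq_sum_of_subset y (t := f.support ∪ g.support) Finset.subset_union_left,
    ordered_eq_sum_of_subset y (t := f.support ∪ g.support) Finset.subset_union_right,
    ← Finset.sum_add_distrib]
  exact Finset.sum_congr rfl fun s _ => by rw [MvPolynomial.coeff_add, add_smul]

theorem ordered_monomial (s : Fin 2 →₀ ℕ) (c : ℂ) :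
    ordered y (MvPolynomial.monomial s c) = c • (star y ^ s 1 * y ^ s 0) := by
  rw [ordered_eq_sum_of_subset y (t := {s}) MvPolynomial.support_monomial_subset,
    Finset.sum_singleton, MvPolynomial.coeff_monomial, if_pos rfl]

theorem ordered_C (c : ℂ) : ordered y (MvPolynomial.C c) = c • (1 : R) := by
  simpa using ordered_monomial y 0 c

theorem ordered_X_zero : ordered y (MvPolynomial.X 0) = y := by
  simpa [MvPolynomial.X] using ordered_monomial y (Finsupp.single 0 1) 1

theorem ordered_X_one : ordered y (MvPolynomial.X 1) = star y := by
  simpa [MvPolynomial.X] using ordered_monomial y (Finsupp.single 1 1) 1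

theorem ordered_X_one_mul_X_zero :
    ordered y (MvPolynomial.X 1 * MvPolynomial.X 0) = star y * y := by
  have h := ordered_monomial y (Finsupp.single 1 1 + Finsupp.single 0 1) 1
  rw [MvPolynomial.monomial_add_single] at h
  simpa [MvPolynomial.X] using h

end Ordered

@[simp] theorem slice_tmul {A B : Type} [AddCommGroup A] [Module ℂ A] [AddCommGroup B]
    [Module ℂ B] (ρ : B →ₗ[ℂ] ℂ) (a : A) (b : B) : slice ρ (a ⊗ₜ[ℂ] b) = ρ b • a := by
  simp [slice]

namespace Oscillator

variable {S : Oscillator}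

/-! ### Low-order moments of the indirect measurement -/

section Meas

variable {μ : ℝ} {m : Symb →ₗ[ℂ] ℂ} {R : Type} [Ring R] [StarRing R] [Algebra ℂ R]

theorem MeasMoments.measInt_one (hm : S.MeasMoments μ m) (y : R) :
    measInt m y (mono (0, 0)) = 1 := by
  have h : smear m (mono (0, 0)) = MvPolynomial.C 1 := by
    simp [smear, mono, Algebra.TensorProduct.one_def, hm.one]
  rw [measInt, h, ordered_C, one_smul]

theorem MeasMoments.measInt_conj (hm : S.MeasMoments μ m) (y : R) :
    measInt m y (mono (1, 0)) = star y := by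
  have h : smear m (mono (1, 0)) = MvPolynomial.X 1 := by
    simp [smear, mono, hm.one, hm.mean_conj]
  rw [measInt, h, ordered_X_one]

theorem MeasMoments.measInt_id (hm : S.MeasMoments μ m) (y : R) :
    measInt m y (mono (0, 1)) = y := by
  have h : smear m (mono (0, 1)) = MvPolynomial.X 0 := by
    simp [smear, mono, hm.one, hm.mean]
  rw [measInt, h, ordered_X_zero]

/-- Expanding the shifted variables leaves two cross terms, killed by the zero means, and the
measurement variance as a scalar. -/
theorem MeasMoments.measInt_sq (hm : S.MeasMoments μ m) (y : R) :
    measInt m y (mono (1, 1)) = star y * y + ((S.hbar : ℂ) * μ) • 1 := by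
  have h : smear m (mono (1, 1)) =
      MvPolynomial.X 1 * MvPolynomial.X 0 + MvPolynomial.C ((S.hbar : ℂ) * μ) := by
    simp [smear, mono, mul_add, add_mul, hm.one, hm.mean, hm.mean_conj, hm.cov,
      MvPolynomial.smul_eq_C_mul]
  rw [measInt, h, ordered_add, ordered_X_one_mul_X_zero, ordered_C]

end Meas

/-! ### One step of the channel on quadratic operators -/

theorem evolve_x (u : ℂ) : S.evolve u S.x = S.xNext u := ccrLift_gen ..

theorem evolve_star_x (u : ℂ) : S.evolve u (star S.x) = star (S.xNext u) := by
  rw [x, star_gen]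
  exact ccrLift_genAdj ..

section Noise

variable {σ ν : ℝ} {υ : ℂ} {ρ : S.Noise →ₗ[ℂ] ℂ}

theorem NoiseMoments.transition_one (hρ : S.NoiseMoments σ ν υ ρ) :
    S.transition ρ 1 = 1 := by
  simp [transition, Algebra.TensorProduct.one_def, hρ.one]

theorem NoiseMoments.transition_star_xNext_mul_xNext (hρ : S.NoiseMoments σ ν υ ρ) (u : ℂ) :
    S.transition ρ (star (S.xNext u) * S.xNext u) =
      star (S.φ • S.x + (S.β * u) • 1) * (S.φ • S.x + (S.β * u) • 1)
        + ((S.hbar : ℂ) * σ) • 1 := by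
  simp only [transition, xNext, star_add, star_smul, TensorProduct.star_tmul, star_one, add_mul,
    mul_add, smul_mul_assoc, mul_smul_comm, Algebra.TensorProduct.tmul_mul_tmul, one_mul, mul_one,
    smul_add, smul_smul, Algebra.TensorProduct.one_def, RCLike.star_def, map_add, map_smul,
    slice_tmul, hρ.one, hρ.mean_v, hρ.mean_v_star, hρ.cov_vv]
  module

/-- Linear error dynamics: `(A + κ y') - x' = (φ - κ γ) (z - x) + κ w - v`, where
`A = φ z + β u - κ (γ z + δ u)`. -/
theorem filterStep_sub_xNext (κ z u : ℂ) :
    S.filterStep κ z u 0 • 1 + κ • S.yNext u + (-1 : ℂ) • S.xNext u =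
      (S.φ - κ * S.γ) • ((z • 1 - S.x) ⊗ₜ[ℂ] (1 : S.Noise))
        + (1 : S.Obj) ⊗ₜ[ℂ] (κ • S.w + (-1 : ℂ) • S.v) := by
  -- Differences become sums with coefficient `-1`, so that additivity and homogeneity of `⊗`
  -- suffice.
  rw [show z • (1 : S.Obj) - S.x = z • 1 + (-1 : ℂ) • S.x by module]
  simp only [filterStep, xNext, yNext, TensorProduct.add_tmul, TensorProduct.tmul_add,
    TensorProduct.tmul_smul, ← TensorProduct.smul_tmul', Algebra.TensorProduct.one_def]
  module

/-- The signs in `κ w - v` and in the covariance of `w*` with `v` cancel, so the mixed terms enter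
with a plus. The adjoint stands on the left, so only normally ordered moments occur. -/
theorem NoiseMoments.transition_star_mul_self (hρ : S.NoiseMoments σ ν υ ρ) (c κ : ℂ)
    (e : S.Obj) :
    S.transition ρ (star (c • (e ⊗ₜ[ℂ] (1 : S.Noise)) + (1 : S.Obj) ⊗ₜ[ℂ] (κ • S.w + (-1 : ℂ) • S.v)) *
        (c • (e ⊗ₜ[ℂ] (1 : S.Noise)) + (1 : S.Obj) ⊗ₜ[ℂ] (κ • S.w + (-1 : ℂ) • S.v))) =
      (c * conj c) • (star e * e)
        + ((S.hbar : ℂ) * (σ + (κ * conj υ + conj κ * υ) + ν * (κ * conj κ))) • 1 := by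
  simp only [transition, star_add, star_smul, TensorProduct.star_tmul, star_one, add_mul,
    mul_add, smul_mul_assoc, mul_smul_comm, Algebra.TensorProduct.tmul_mul_tmul,
    one_mul, mul_one, smul_add, smul_smul, RCLike.star_def, map_add, map_neg, map_one, map_smul,
    slice_tmul, hρ.one, hρ.mean_v, hρ.mean_v_star, hρ.mean_w, hρ.mean_w_star, hρ.cov_vv, hρ.cov_ww,
    hρ.cov_wv, hρ.cov_vw, smul_eq_mul]
  module

end Noise

/-! ### Integration of quadratic functions of the result -/

/-- The polynomial coefficients of a quadratic cost-to-go in the measurement result. -/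
noncomputable def quadCoeffs (D : S.Obj) (G κ : ℂ) (e : S.Obj) : ℕ × ℕ →₀ S.Obj :=
  Finsupp.single (0, 0) (D + G • (star e * e)) + Finsupp.single (1, 0) ((G * conj κ) • e)
    + Finsupp.single (0, 1) ((G * κ) • star e) + Finsupp.single (1, 1) ((G * (κ * conj κ)) • 1)

/-- The map `h` is arbitrary because it serves twice: as evaluation at `η`, and as integration of
each monomial by `instr`. -/
theorem quadCoeffs_sum {M : Type} [AddCommGroup M] (D : S.Obj) (G κ : ℂ) (e : S.Obj)
    (h : ℕ × ℕ → S.Obj → M) (h0 : ∀ p, h p 0 = 0) (hadd : ∀ p a b, h p (a + b) = h p a + h p b) :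
    (quadCoeffs D G κ e).sum h =
      h (0, 0) (D + G • (star e * e)) + h (1, 0) ((G * conj κ) • e)
        + h (0, 1) ((G * κ) • star e) + h (1, 1) ((G * (κ * conj κ)) • 1) := by
  classical
  rw [quadCoeffs, Finsupp.sum_add_index' h0 hadd, Finsupp.sum_add_index' h0 hadd,
    Finsupp.sum_add_index' h0 hadd, Finsupp.sum_single_index (h0 _),
    Finsupp.sum_single_index (h0 _), Finsupp.sum_single_index (h0 _),
    Finsupp.sum_single_index (h0 _)]

theorem filterStep_eq_add (κ z u η : ℂ) :
    S.filterStep κ z u η = S.filterStep κ z u 0 + κ * η := by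
  simp only [filterStep]
  ring

theorem hasCoeffs_quadratic (D : S.Obj) (G κ z u : ℂ) :
    S.HasCoeffs (fun η => D + G • (star (S.filterStep κ z u η • 1 - S.x) *
        (S.filterStep κ z u η • 1 - S.x)))
      (quadCoeffs D G κ (S.filterStep κ z u 0 • 1 - S.x)) := by
  intro η
  rw [quadCoeffs_sum _ _ _ _ _ (by simp) (fun p a b => smul_add _ a b)]
  beta_reduce
  rw [filterStep_eq_add κ z u η]
  generalize S.filterStep κ z u 0 = A
  simp only [star_add, star_sub, star_smul, star_one, sub_mul, mul_sub,
    smul_mul_assoc, mul_smul_comm, one_mul, mul_one, RCLike.star_def, map_mul, pow_zero,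
    pow_one]
  module

variable {σ ν μ : ℝ} {υ : ℂ} {ρ : S.Noise →ₗ[ℂ] ℂ} {m : Symb →ₗ[ℂ] ℂ}

theorem instr_zero (u : ℂ) (f : Symb) : S.instr u ρ m f 0 = 0 := by
  simp [instr]

theorem instr_add (u : ℂ) (f : Symb) (a b : S.Obj) :
    S.instr u ρ m f (a + b) = S.instr u ρ m f a + S.instr u ρ m f b := by
  simp [instr, mul_add]

/-- Regrouping of a quadratic expression in the commuting operators `X` and `Y`, with the variance
`c` of the indirect measurement of `Y`. -/
theorem indirect_square {R : Type} [Ring R] [StarRing R] [Algebra ℂ R] [StarModule ℂ R]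
    {X Y : R} (D O G κ A c : ℂ) (hy : Y * star X = star X * Y) :
    D • (1 : R) + O • (star X * X) + G • ((conj A • 1 - star X) * (A • 1 - X))
        + star Y * (G * conj κ) • (A • 1 - X) + Y * (G * κ) • (conj A • 1 - star X)
        + (star Y * Y + c • 1) * (G * (κ * conj κ)) • 1 =
      (D + G * (c * (κ * conj κ))) • 1 + O • (star X * X)
        + G • (star (A • 1 + κ • Y + (-1 : ℂ) • X) * (A • 1 + κ • Y + (-1 : ℂ) • X)) := by
  simp only [star_add, star_smul, star_one, add_mul, mul_add, sub_mul, mul_sub,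
    smul_mul_assoc, mul_smul_comm, one_mul, mul_one, RCLike.star_def, hy, map_neg, map_one]
  module

/-- The measurement adds `G ℏ μ |κ|²` to the result of substituting `y` for `η`; this is why `μ`
appears only in the sum `ν + μ`. -/
theorem instrInt_quadratic (hρ : S.NoiseMoments σ ν υ ρ) (hm : S.MeasMoments μ m)
    (D O G κ z u : ℂ) :
    S.instrInt u ρ m (fun η => (D • 1 + O • (star S.x * S.x)) +
        G • (star (S.filterStep κ z u η • 1 - S.x) * (S.filterStep κ z u η • 1 - S.x))) =
      (D + S.hbar * (O * σ + G * (σ + (κ * conj υ + conj κ * υ) + (ν + μ) * (κ * conj κ)))) • 1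
        + O • (star (S.φ • S.x + (S.β * u) • 1) * (S.φ • S.x + (S.β * u) • 1))
        + (G * ((S.φ - κ * S.γ) * conj (S.φ - κ * S.γ))) •
            (star (z • 1 - S.x) * (z • 1 - S.x)) := by
  rw [S.instrInt_eq u ρ m (hasCoeffs_quadratic _ G κ z u),
    quadCoeffs_sum _ _ _ _ _ (fun p => instr_zero u _) (fun p => instr_add u _)]
  have hx := evolve_x (S := S) u
  have hxs := evolve_star_x (S := S) u
  have hy := S.yNext_star_xNext u
  have key := hρ.transition_star_mul_self (S.φ - κ * S.γ) κ (z • 1 - S.x)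
  -- Read backwards, the error dynamics turns the moment formula into one for the square of `A + κ Y
  -- - X`.
  rw [← filterStep_sub_xNext] at key
  have hxx := hρ.transition_star_xNext_mul_xNext u
  have h1 := hρ.transition_one
  simp only [instr, hm.measInt_one, hm.measInt_conj, hm.measInt_id, hm.measInt_sq,
    star_sub, star_smul, star_one, map_add, map_sub, map_smul, map_mul, map_one, hx, hxs,
    RCLike.star_def, one_mul]
  generalize S.filterStep κ z u 0 = A at *
  set Y := S.yNext u
  set X := S.xNext u
  have hsum := indirect_square (R := S.Joint) (X := X) (Y := Y) D O G κ A (S.hbar * μ) hy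
  have := congrArg (S.transition ρ) hsum
  simp only [map_add, map_smul] at this
  refine this.trans ?_
  rw [key, hxx, h1]
  simp only [star_sub, star_smul, star_one, map_sub, map_mul, RCLike.star_def]
  module

/-! ### Completion of the square -/

theorem ofReal_norm_sq (c : ℂ) : ((‖c‖ : ℝ) : ℂ) ^ 2 = c * conj c := (Complex.mul_conj' c).symm

/-- The Bellman step of the linear-quadratic problem, with `l Υ = φ conj β Ω' - ϑ`. -/
theorem bellman_step {Ω' ω ϑ₁ Υ : ℝ} {ϑ l : ℂ} (hΥ : Υ = ‖S.β‖ ^ 2 * Ω' + ϑ₁)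
    (hl : S.φ * conj S.β * Ω' - ϑ = l * Υ) (z u : ℂ) :
    (Ω' : ℂ) • (star (S.φ • S.x + (S.β * u) • 1) * (S.φ • S.x + (S.β * u) • 1))
        + S.runLoss ω ϑ₁ ϑ u =
      ((Υ * ‖u + l * z‖ ^ 2 : ℝ) : ℂ) • 1
        + ((‖S.φ‖ ^ 2 * Ω' + ω - ‖l‖ ^ 2 * Υ : ℝ) : ℂ) • (star S.x * S.x)
        + ((‖l‖ ^ 2 * Υ : ℝ) : ℂ) • (star (z • 1 - S.x) * (z • 1 - S.x))
        - ((l * Υ * conj (u + l * z)) • (z • 1 - S.x)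
            + star ((l * Υ * conj (u + l * z)) • (z • 1 - S.x))) := by
  -- Eliminating `ϑ` and `ϑ₁` leaves a division-free identity in the independent parameters, which
  -- `module` can check.
  obtain rfl : ϑ = S.φ * conj S.β * Ω' - l * Υ := by rw [← hl]; ring
  obtain rfl : ϑ₁ = Υ - ‖S.β‖ ^ 2 * Ω' := by rw [hΥ]; ring
  simp only [runLoss, star_add, star_sub, star_smul, star_one, add_mul, mul_add, sub_mul, mul_sub,
    smul_mul_assoc, mul_smul_comm, one_mul, mul_one, RCLike.star_def, map_add, map_sub, map_mul,
    Complex.ofReal_add, Complex.ofReal_sub, Complex.ofReal_mul, Complex.ofReal_pow,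
    ofReal_norm_sq, Complex.conj_conj, Complex.conj_ofReal]
  module

end Oscillator

end QControl

/-! ### Backward induction -/

theorem theorem4 (S : QControl.Oscillator) (K : ℕ)
    -- loss parameters
    (ΩK ω ϑ₁ : ℝ) (ϑ : ℂ) (hΩK : 0 ≤ ΩK) (hω : 0 ≤ ω) (hϑ₁ : 0 < ϑ₁)
    -- noise states and measurements, given by their first and second moments
    (σ ν μ s₀ : ℝ) (υ z₀ : ℂ)
    (ρ : ℕ → S.Noise →ₗ[ℂ] ℂ) (hρ : ∀ k ∈ Finset.Icc 1 K, S.NoiseMoments σ ν υ (ρ k))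
    (m : ℕ → QControl.Symb →ₗ[ℂ] ℂ) (hm : ∀ k ∈ Finset.Icc 1 K, S.MeasMoments μ (m k))
    -- Kalman gains
    (κ : ℕ → ℂ) (hκ : κ = S.kappa σ ν μ υ s₀)
    -- backward recursions
    (Ω Υ Γ d : ℕ → ℝ) (lam Λ : ℕ → ℂ)
    (hΛ : ∀ k < K, Λ k = S.φ * conj S.β * Ω (k + 1) - ϑ)
    (hΥ : ∀ k < K, Υ k = ‖S.β‖ ^ 2 * Ω (k + 1) + ϑ₁)
    (hΥ0 : ∀ k < K, Υ k ≠ 0)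
    (hlam : ∀ k < K, lam k = (S.φ * conj S.β * Ω (k + 1) - ϑ) / Υ k)
    (hΩ_final : Ω K = ΩK)
    (hΩ : ∀ k < K, Ω k = ‖S.φ‖ ^ 2 * Ω (k + 1) + ω - ‖lam k‖ ^ 2 * Υ k)
    (hΓ_final : Γ K = 0)
    (hΓ : ∀ k < K, Γ k = ‖lam k‖ ^ 2 * Υ k + ‖S.φ - κ (k + 1) * S.γ‖ ^ 2 * Γ (k + 1))
    (hd : ∀ k < K, d k = S.hbar * ∑ i ∈ Finset.Icc (k + 1) K,
      (Ω i * σ + Γ i * (σ + 2 * (κ i * conj υ).re + (ν + μ) * ‖κ i‖ ^ 2)))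
    -- operators of future losses under the linear strategy
    (a : (k : ℕ) → QControl.Hist k → S.Obj)
    (ha : S.IsFutureLoss K ΩK ω ϑ₁ ϑ ρ m κ z₀ lam a) :
    ∀ k < K, ∀ ζ : QControl.Hist k,
      S.PolyIntegrable (fun η => a (k + 1)
        (ζ.snoc η (-lam (k + 1) * S.filterStep (κ (k + 1)) (S.est κ z₀ ζ) ζ.ctrl η))) ∧
      a k ζ =
        (d k : ℂ) • 1
        + ((Υ k * ‖ζ.ctrl + lam k * S.est κ z₀ ζ‖ ^ 2 : ℝ) : ℂ) • 1
        + (Ω k : ℂ) • (star S.x * S.x)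
        + (Γ k : ℂ) • (star (S.est κ z₀ ζ • 1 - S.x) * (S.est κ z₀ ζ • 1 - S.x))
        - ((Λ k * conj (ζ.ctrl + lam k * S.est κ z₀ ζ)) • (S.est κ z₀ ζ • 1 - S.x)
            + star ((Λ k * conj (ζ.ctrl + lam k * S.est κ z₀ ζ)) •
                (S.est κ z₀ ζ • 1 - S.x))) := by
  have hsnoc : ∀ k (ζ : QControl.Hist k) η u, QControl.Oscillator.est S κ z₀ (ζ.snoc η u) =
      S.filterStep (κ (k + 1)) (S.est κ z₀ ζ) ζ.ctrl η := fun _ _ _ _ => rfl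
  have hctrl : ∀ k (ζ : QControl.Hist k) η u, (ζ.snoc η u).ctrl = u := fun _ _ _ _ => rfl
  have hre : ∀ i, ((S.hbar * (Ω i * σ + Γ i * (σ + 2 * (κ i * conj υ).re
      + (ν + μ) * ‖κ i‖ ^ 2)) : ℝ) : ℂ) = S.hbar * (Ω i * σ + Γ i *
        (σ + (κ i * conj υ + conj (κ i) * υ) + (ν + μ) * (κ i * conj (κ i)))) := by
    intro i
    have h2 := Complex.add_conj (κ i * conj υ)
    rw [map_mul, Complex.conj_conj] at h2
    rw [h2, ← QControl.Oscillator.ofReal_norm_sq]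
    push_cast
    ring
  -- a quadratic cost-to-go with zero control deviation is propagated to the preceding instant
  have hstep : ∀ k < K, ∀ ζ : QControl.Hist k,
      (∃ D : ℂ, (d k : ℂ) = D + S.hbar * (Ω (k + 1) * σ + Γ (k + 1) *
          (σ + (κ (k + 1) * conj υ + conj (κ (k + 1)) * υ)
            + (ν + μ) * (κ (k + 1) * conj (κ (k + 1))))) ∧
        (fun η => a (k + 1)
          (ζ.snoc η (-lam (k + 1) * S.filterStep (κ (k + 1)) (S.est κ z₀ ζ) ζ.ctrl η))) =
        fun η => (D • 1 + (Ω (k + 1) : ℂ) • (star S.x * S.x)) + (Γ (k + 1) : ℂ) •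
          (star (S.filterStep (κ (k + 1)) (S.est κ z₀ ζ) ζ.ctrl η • 1 - S.x) *
            (S.filterStep (κ (k + 1)) (S.est κ z₀ ζ) ζ.ctrl η • 1 - S.x))) →
      a k ζ =
        (d k : ℂ) • 1
        + ((Υ k * ‖ζ.ctrl + lam k * S.est κ z₀ ζ‖ ^ 2 : ℝ) : ℂ) • 1
        + (Ω k : ℂ) • (star S.x * S.x)
        + (Γ k : ℂ) • (star (S.est κ z₀ ζ • 1 - S.x) * (S.est κ z₀ ζ • 1 - S.x))
        - ((Λ k * conj (ζ.ctrl + lam k * S.est κ z₀ ζ)) • (S.est κ z₀ ζ • 1 - S.x)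
            + star ((Λ k * conj (ζ.ctrl + lam k * S.est κ z₀ ζ)) •
                (S.est κ z₀ ζ • 1 - S.x))) := by
    rintro k hk ζ ⟨D, hD, hF⟩
    have hl : S.φ * conj S.β * Ω (k + 1) - ϑ = lam k * Υ k := by
      rw [hlam k hk, div_mul_cancel₀ _ (by exact_mod_cast hΥ0 k hk)]
    -- The rearrangement of sums puts the running loss next to the propagated `Ω (k + 1)` term, as
    -- `bellman_step` requires; the propagated error term stays apart and joins `Γ k`.
    rw [ha.step k hk ζ, hF, QControl.Oscillator.instrInt_quadratic
      (hρ (k + 1) (Finset.mem_Icc.2 (by omega))) (hm (k + 1) (Finset.mem_Icc.2 (by omega))),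
      ← hD, add_right_comm, add_assoc ((d k : ℂ) • 1), QControl.Oscillator.bellman_step (hΥ k hk) hl (S.est κ z₀ ζ),
      hΛ k hk, hl, hΩ k hk, hΓ k hk]
    push_cast
    simp only [QControl.Oscillator.ofReal_norm_sq]
    module
  -- Here `n = K - k - 1` counts the steps from `k + 1` to the horizon, so the induction runs
  -- backward in time.
  have hD : ∀ n k, k + n + 1 = K → ∀ ζ : QControl.Hist k,
      (∃ D : ℂ, (d k : ℂ) = D + S.hbar * (Ω (k + 1) * σ + Γ (k + 1) *
          (σ + (κ (k + 1) * conj υ + conj (κ (k + 1)) * υ)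
            + (ν + μ) * (κ (k + 1) * conj (κ (k + 1))))) ∧
        (fun η => a (k + 1)
          (ζ.snoc η (-lam (k + 1) * S.filterStep (κ (k + 1)) (S.est κ z₀ ζ) ζ.ctrl η))) =
        fun η => (D • 1 + (Ω (k + 1) : ℂ) • (star S.x * S.x)) + (Γ (k + 1) : ℂ) •
          (star (S.filterStep (κ (k + 1)) (S.est κ z₀ ζ) ζ.ctrl η • 1 - S.x) *
            (S.filterStep (κ (k + 1)) (S.est κ z₀ ζ) ζ.ctrl η • 1 - S.x))) := by
    intro n
    induction n with
    | zero =>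
      intro k hkn ζ
      obtain rfl : k + 1 = K := by omega
      -- The value `d K` is not prescribed, so the constant of the terminal loss is the explicit
      -- witness `0`; the error term is free since `Γ K = 0`.
      refine ⟨0, ?_, funext fun η => ?_⟩
      · rw [← hre, hd k (by omega), Finset.Icc_self, Finset.sum_singleton, zero_add]
      · rw [ha.final, hΓ_final, hΩ_final]
        simp
    | succ n ih =>
      intro k hkn ζ
      refine ⟨d (k + 1), ?_, funext fun η => ?_⟩
      · rw [← hre, hd k (by omega), hd (k + 1) (by omega),
          ← Finset.insert_Icc_add_one_left_eq_Icc (by omega : k + 1 ≤ K),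
          Finset.sum_insert (by simp)]
        push_cast
        ring
      -- The control appended to the data is `-λ z` at the updated estimate, so the squared
      -- deviation and the cross terms vanish.
      · rw [hstep (k + 1) (by omega) _ (ih (k + 1) (by omega) _), hsnoc, hctrl]
        simp
  intro k hk ζ
  have h := hD (K - k - 1) k (by omega) ζ
  refine ⟨?_, hstep k hk ζ h⟩
  obtain ⟨D, -, hF⟩ := h
  exact hF ▸ ⟨_, QControl.Oscillator.hasCoeffs_quadratic _ _ _ _ _⟩
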